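/- Let $n,d\ge 1$ and $0<\mu\le L$, $\tilde L\ge 0$. For $i\in[n]$ let $f_i:\mathbb R^d\to\mathbb R$ be twice continuously differentiable and such that for all $x,y\in\mathbb R^d$ $$\tfrac{\mu}{2}\|y-x\|^2\le f_i(y)-f_i(x)-\langle\nabla f_i(x),y-x\rangle\le\tfrac{L}{2}\|y-x\|^2,\qquad \|\nabla^2f_i(y)-\nabla^2f_i(x)\|\le\tilde L\|y-x\|$$ (Euclidean norm and spectral norm), and let $x^\star$ be the minimizer of $\frac1n\sum_{i=1}^n f_i$. Put $M=\tilde L\mu^{-3/2}$. Notation. For $d\times d$ matrices $B,K$ let $\sigma(B,K)=\mathrm{Tr}\big((K^{-1})^{\mathsf T}(B-K)\big)$, and for $u\in\mathbb R^d$ let $$\mathrm{BFGS}(B,K,u)=B-\frac{Buu^{\mathsf T}B}{\langle u,Bu\rangle}+\frac{Kuu^{\mathsf T}K}{\langle u,Ku\rangle},\qquad \mathrm{BFGS}(B,K,0)=B.$$ Let $\bar u(B,K)$ be any maximizer of $\langle u,Bu\rangle/\langle u,Ku\rangle$ over the standard basis vectors $u\in\{e_1,\dots,e_d\}$. The SLIQN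 method with correction factors $(\alpha_k)_{k\ge0}$, started from $x^0\in\mathbb R^d$ and matrices $I_i^0\succeq\nabla^2f_i(x^0)$ $(i\in[n])$, sets $z_i^0=x^0$, $D_i^0=(1+\alpha_0)^2I_i^0$, and for $t\ge1$, with $i_t=1+(t-1)\bmod n$ and with $\omega_t=(1+\alpha_{\lceil t/n\rceil})^2$ if $n\mid t$ and $\omega_t=1$ otherwise, $$x^t=\Big(\sum_{i=1}^nD_i^{t-1}\Big)^{-1}\sum_{i=1}^n\big(D_i^{t-1}z_i^{t-1}-\nabla f_i(z_i^{t-1})\big),\qquad z_{i_t}^t=x^t,$$ $$z_i^t=z_i^{t-1},\quad D_i^t=\omega_tD_i^{t-1}\quad(i\ne i_t),$$ $$Q^t=\mathrm{BFGS}\big(D_{i_t}^{t-1},(1+\alpha_{\lceil t/n-1\rceil})K^t,z_{i_t}^t-z_{i_t}^{t-1}\big),\quad K^t=\int_0^1\nabla^2f_{i_t}\big(z_{i_t}^{t-1}+\tau(z_{i_t}^t-z_{i_t}^{t-1})\big)\,d\tau,$$ $$D_{i_t}^t=\omega_t\,\mathrm{BFGS}\big(Q^t,\nabla^2f_{i_t}(z_{i_t}^t),\bar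 u(Q^t,\nabla^2f_{i_t}(z_{i_t}^t))\big).$$ Theorem. For every $\rho$ with $0<\rho<1-\frac{\mu}{dL}$ there exist $\varepsilon>0$ and $\sigma_0>0$ such that the following holds for the SLIQN method with correction factors $\alpha_k=M\sqrt L\,\varepsilon\rho^k$. If $\|x^0-x^\star\|\le\varepsilon$, $I_i^0\succeq\nabla^2f_i(x^0)$ and $\sigma(I_i^0,\nabla^2f_i(x^0))\le\sigma_0$ for all $i\in[n]$, then there is a sequence $(\zeta^k)_{k\ge0}$ with $$\|x^t-x^\star\|\le\zeta^{\lfloor (t-1)/n\rfloor}\quad\text{for all }t\ge1,\qquad \zeta^k\le\varepsilon\Big(1-\frac{\mu}{dL}\Big)^{\frac{(k+1)(k+2)}{2}}\quad\text{for all }k\ge0.$$ -/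

import Mathlib

noncomputable section

namespace SLIQN

open Matrix

/-- The space `ℝ^d` with its Euclidean norm. -/
abbrev Vec (d : ℕ) := EuclideanSpace ℝ (Fin d)

/-- Real `d × d` matrices. -/
abbrev Mat (d : ℕ) := Matrix (Fin d) (Fin d) ℝ

/-- The spectral norm of a matrix: its operator norm with respect to the Euclidean norm. -/
def specNorm {d : ℕ} (A : Mat d) : ℝ :=
  ‖(Matrix.toEuclideanCLM (n := Fin d) (𝕜 := ℝ) A)‖

/-- The Hessian matrix of `f` at `x`: column `j` is the derivative of the gradient of `f`
in the direction of the `j`-th basis vector. -/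
def hess {d : ℕ} (f : Vec d → ℝ) (x : Vec d) : Mat d :=
  Matrix.of fun i j => (fderiv ℝ (gradient f) x (EuclideanSpace.single j 1)) i

/-- `f` is `μ`-strongly convex (for differentiable `f`). -/
def StronglyConvex {d : ℕ} (μ : ℝ) (f : Vec d → ℝ) : Prop :=
  ∀ x y : Vec d, μ / 2 * ‖y - x‖ ^ 2 ≤ f y - f x - inner ℝ (gradient f x) (y - x)

/-- `f` is `L`-smooth (for differentiable `f`). -/
def Smooth {d : ℕ} (L : ℝ) (f : Vec d → ℝ) : Prop :=
  ∀ x y : Vec d, f y - f x - inner ℝ (gradient f x) (y - x) ≤ L / 2 * ‖y - x‖ ^ 2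

/-- The Hessian of `f` is Lipschitz with constant `Lt` in the spectral norm. -/
def LipschitzHessian {d : ℕ} (Lt : ℝ) (f : Vec d → ℝ) : Prop :=
  ∀ x y : Vec d, specNorm (hess f y - hess f x) ≤ Lt * ‖y - x‖

/-- The Hessian approximation error `σ(B, K) = ⟨K⁻¹, B - K⟩ = Tr((K⁻¹)ᵀ (B - K))`. -/
def sigma {d : ℕ} (B K : Mat d) : ℝ :=
  ((K⁻¹)ᵀ * (B - K)).trace

/-- The generalized BFGS update
`B - (B u uᵀ B) / ⟨u, B u⟩ + (K u uᵀ K) / ⟨u, K u⟩`.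
For `u = 0` both correction terms vanish, so the update leaves `B` unchanged. -/
def bfgs {d : ℕ} (B K : Mat d) (u : Fin d → ℝ) : Mat d :=
  B - (u ⬝ᵥ (B *ᵥ u))⁻¹ • (B * vecMulVec u u * B)
    + (u ⬝ᵥ (K *ᵥ u))⁻¹ • (K * vecMulVec u u * K)

/-- `u` is a greedy vector for `(B, K)`: it maximizes `⟨u, B u⟩ / ⟨u, K u⟩` among the
standard basis vectors (ties may be broken arbitrarily). -/
def IsGreedy {d : ℕ} (B K : Mat d) (u : Fin d → ℝ) : Prop :=
  (∃ k : Fin d, u = Pi.single k 1) ∧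
    ∀ v : Fin d → ℝ, (∃ j : Fin d, v = Pi.single j 1) →
      (v ⬝ᵥ (B *ᵥ v)) / (v ⬝ᵥ (K *ᵥ v)) ≤ (u ⬝ᵥ (B *ᵥ u)) / (u ⬝ᵥ (K *ᵥ u))

/-- The averaged Hessian `∫₀¹ ∇²f(z + τ (z' - z)) dτ`, entry by entry. -/
def avgHess {d : ℕ} (f : Vec d → ℝ) (z z' : Vec d) : Mat d :=
  Matrix.of fun i j => ∫ τ in (0 : ℝ)..1, hess f (z + τ • (z' - z)) i j

/-- The correction factors `α_k = M √L ε ρ^k`, where `M = Lt / μ^(3/2)`. -/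
def alpha (μ L Lt ε ρ : ℝ) (k : ℕ) : ℝ :=
  Lt / μ ^ (3 / 2 : ℝ) * √L * ε * ρ ^ k

/-- The scaling `ω_t`, equal to `(1 + α_⌈t/n⌉)²` if `n` divides `t` and to `1` otherwise. -/
def omega (n : ℕ) (α : ℕ → ℝ) (t : ℕ) : ℝ :=
  if t % n = 0 then (1 + α ⌈(t : ℝ) / n⌉₊) ^ 2 else 1

/-- The index `i_t` of the tuple updated in iteration `t ≥ 1`; with the indices `0, …, n - 1`
it is `(t - 1) mod n`. -/
def idx (n : ℕ) [NeZero n] (t : ℕ) : Fin n :=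
  ⟨(t - 1) % n, Nat.mod_lt _ (NeZero.pos n)⟩

/-- The sequences `x, z, D, Q, u` are a run of the sharpened lazy incremental quasi-Newton method
on `f_1, …, f_n` with correction factors `α`, initial point `x 0` and initial Hessian
approximations `I₀`.  The clauses other than the two about time `0` describe the iteration that
leads from time `t` to time `t + 1`. -/
structure IsRun {n d : ℕ} [NeZero n] (f : Fin n → Vec d → ℝ) (α : ℕ → ℝ) (I₀ : Fin n → Mat d)
    (x : ℕ → Vec d) (z : ℕ → Fin n → Vec d) (D : ℕ → Fin n → Mat d) (Q : ℕ → Mat d)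
    (u : ℕ → Fin d → ℝ) : Prop where
  z_zero : ∀ i, z 0 i = x 0
  D_zero : ∀ i, D 0 i = (1 + α 0) ^ 2 • I₀ i
  x_succ : ∀ t, x (t + 1) =
    Matrix.toEuclideanLin (∑ i, D t i)⁻¹
      (∑ i, (Matrix.toEuclideanLin (D t i) (z t i) - gradient (f i) (z t i)))
  z_succ : ∀ t, z (t + 1) (idx n (t + 1)) = x (t + 1)
  z_succ_of_ne : ∀ t i, i ≠ idx n (t + 1) → z (t + 1) i = z t i
  D_succ_of_ne : ∀ t i, i ≠ idx n (t + 1) → D (t + 1) i = omega n α (t + 1) • D t i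
  Q_succ : ∀ t, Q (t + 1) =
    bfgs (D t (idx n (t + 1)))
      ((1 + α ⌈((t + 1 : ℕ) : ℝ) / n - 1⌉₊) •
        avgHess (f (idx n (t + 1))) (z t (idx n (t + 1))) (z (t + 1) (idx n (t + 1))))
      (WithLp.ofLp (z (t + 1) (idx n (t + 1)) - z t (idx n (t + 1))))
  u_succ : ∀ t, IsGreedy (Q (t + 1))
    (hess (f (idx n (t + 1))) (z (t + 1) (idx n (t + 1)))) (u (t + 1))
  D_succ : ∀ t, D (t + 1) (idx n (t + 1)) = omega n α (t + 1) •
    bfgs (Q (t + 1)) (hess (f (idx n (t + 1))) (z (t + 1) (idx n (t + 1)))) (u (t + 1))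

end SLIQN

end

/-!
The invariant is that each approximation `D` dominates a multiple `s` of the Hessian, `1 ≤ s`, with
a small error `σ(D, s ∇²f)`. A BFGS update towards `K ⪯ B` keeps the order and does not increase
`σ(B, K)`, and in a greedy direction it contracts `σ` by the factor `q = 1 - μ / (d L)`. As the
averaged Hessian and the Hessians at both ends of a step lie within a factor `1 + α` of each other,
replacing one by another multiplies `d + σ` by at most a power of `1 + α`. The errors therefore
decay like `q ^ k` over the epochs `k`: since `ρ < q`, the corrections `α k` of order `ρ ^ k` are of
lower order.

The distance to the minimizer after a Newton-type step is at most `(L e + Lt r) r / μ`, where `e`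
and `r` bound the Hessian errors and the previous distances. The factor in front of `r` is thus of
order `q ^ k` in epoch `k`, and the product of these factors is the superlinear rate.
-/

namespace SLIQN

open Matrix Finset
open scoped MatrixOrder

section LoewnerOrder

variable {m : Type*} {A B : Matrix m m ℝ}

theorem posDef_of_le (hA : A.PosDef) (h : A ≤ B) : B.PosDef := by
  simpa using hA.add_posSemidef (Matrix.le_iff.1 h)

variable [Fintype m]

theorem dotProduct_mulVec_le_of_le (h : A ≤ B) (v : m → ℝ) :
    v ⬝ᵥ (A *ᵥ v) ≤ v ⬝ᵥ (B *ᵥ v) := by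
  have := (Matrix.le_iff.1 h).dotProduct_mulVec_nonneg v
  rwa [star_trivial, sub_mulVec, dotProduct_sub, sub_nonneg] at this

theorem le_of_dotProduct_mulVec_le (hA : A.IsHermitian) (hB : B.IsHermitian)
    (h : ∀ v, v ⬝ᵥ (A *ᵥ v) ≤ v ⬝ᵥ (B *ᵥ v)) : A ≤ B := by
  refine Matrix.le_iff.2 (.of_dotProduct_mulVec_nonneg (hB.sub hA) fun v => ?_)
  rw [star_trivial, sub_mulVec, dotProduct_sub, sub_nonneg]
  exact h v

theorem dotProduct_mulVec_comm (hA : A.IsHermitian) (v w : m → ℝ) :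
    v ⬝ᵥ (A *ᵥ w) = w ⬝ᵥ (A *ᵥ v) := by
  rw [dotProduct_mulVec, ← mulVec_transpose, ← conjTranspose_eq_transpose_of_trivial, hA.eq,
    dotProduct_comm]

theorem dotProduct_mulVec_sub_smul (hA : A.IsHermitian) (v u : m → ℝ) (s : ℝ) :
    (v - s • u) ⬝ᵥ (A *ᵥ (v - s • u)) =
      v ⬝ᵥ (A *ᵥ v) - 2 * s * (u ⬝ᵥ (A *ᵥ v)) + s ^ 2 * (u ⬝ᵥ (A *ᵥ u)) := by
  simp only [mulVec_sub, mulVec_smul, dotProduct_sub, sub_dotProduct, smul_dotProduct,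
    dotProduct_smul, smul_eq_mul, dotProduct_mulVec_comm hA v u]
  ring

theorem dotProduct_mulVec_sq_le (hA : 0 ≤ A) (v w : m → ℝ) :
    (v ⬝ᵥ (A *ᵥ w)) ^ 2 ≤ (v ⬝ᵥ (A *ᵥ v)) * (w ⬝ᵥ (A *ᵥ w)) := by
  have h : ∀ s : ℝ, 0 ≤ (v ⬝ᵥ (A *ᵥ v)) * (s * s) + (-2 * (v ⬝ᵥ (A *ᵥ w))) * s
      + w ⬝ᵥ (A *ᵥ w) := fun s => by
    have := hA.posSemidef.dotProduct_mulVec_nonneg (w - s • v)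
    rw [star_trivial, dotProduct_mulVec_sub_smul hA.posSemidef.1] at this
    linarith
  have := discrim_le_zero h
  rw [discrim] at this
  linarith

theorem trace_mul_nonneg (hA : 0 ≤ A) (hB : 0 ≤ B) : 0 ≤ (A * B).trace := by
  classical
  obtain ⟨C, rfl⟩ := CStarAlgebra.nonneg_iff_eq_star_mul_self.1 hB
  rw [star_eq_conjTranspose, ← Matrix.mul_assoc, trace_mul_comm, ← Matrix.mul_assoc]
  exact (hA.posSemidef.mul_mul_conjTranspose_same C).trace_nonneg

theorem trace_mul_le_trace_mul_of_le {C : Matrix m m ℝ} (h : A ≤ B) (hC : 0 ≤ C) :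
    (A * C).trace ≤ (B * C).trace := by
  rw [← sub_nonneg, ← trace_sub, ← sub_mul]
  exact trace_mul_nonneg (sub_nonneg.2 h) hC

variable [DecidableEq m]

theorem inv_le_inv_of_le (hA : A.PosDef) (h : A ≤ B) : B⁻¹ ≤ A⁻¹ := by
  have hB := posDef_of_le hA h
  refine le_of_dotProduct_mulVec_le hB.inv.1 hA.inv.1 fun v => ?_
  have hBv : B *ᵥ (B⁻¹ *ᵥ v) = v := by
    rw [mulVec_mulVec, mul_nonsing_inv _ hB.det_pos.ne'.isUnit, one_mulVec]
  have hAv : A *ᵥ (A⁻¹ *ᵥ v) = v := by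
    rw [mulVec_mulVec, mul_nonsing_inv _ hA.det_pos.ne'.isUnit, one_mulVec]
  have hle := dotProduct_mulVec_le_of_le h (B⁻¹ *ᵥ v)
  have hnonneg := hA.posSemidef.dotProduct_mulVec_nonneg (B⁻¹ *ᵥ v - (1 : ℝ) • (A⁻¹ *ᵥ v))
  rw [star_trivial, dotProduct_mulVec_sub_smul hA.1, hAv,
    dotProduct_mulVec_comm hA.1 (A⁻¹ *ᵥ v), hAv] at hnonneg
  rw [hBv] at hle
  rw [dotProduct_comm v, dotProduct_comm v]
  linarith

theorem inv_smul_of_ne_zero (A : Matrix m m ℝ) {a : ℝ} (ha : a ≠ 0) :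
    (a • A)⁻¹ = a⁻¹ • A⁻¹ := by
  by_cases hA : IsUnit A.det
  · simpa only [Units.smul_def, Units.val_mk0, Units.val_inv_eq_inv_val] using
      inv_smul' A (Units.mk0 a ha) hA
  · have : ¬IsUnit (a • A).det := by
      rwa [det_smul, IsUnit.mul_iff, not_and_or, or_iff_right]
      exact not_not.2 (ha.isUnit.pow _)
    rw [nonsing_inv_apply_not_isUnit _ hA, nonsing_inv_apply_not_isUnit _ this, smul_zero]

theorem vecMulVec_self_le (v : m → ℝ) : vecMulVec v v ≤ (v ⬝ᵥ v) • (1 : Matrix m m ℝ) := by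
  refine le_of_dotProduct_mulVec_le (posSemidef_vecMulVec_self_star v).1
    (isHermitian_one.smul (.all _)) fun w => ?_
  have := dotProduct_mulVec_sq_le (zero_le_one (α := Matrix m m ℝ)) v w
  simp only [one_mulVec] at this
  simpa only [vecMulVec_mulVec, smul_mulVec, one_mulVec, dotProduct_smul, smul_eq_mul,
    op_smul_eq_smul, dotProduct_comm w v, ← sq] using this

theorem le_trace_smul_one (hA : 0 ≤ A) : A ≤ A.trace • (1 : Matrix m m ℝ) := by
  refine le_of_dotProduct_mulVec_le hA.posSemidef.1 (isHermitian_one.smul (.all _)) fun v => ?_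
  have := trace_mul_le_trace_mul_of_le (vecMulVec_self_le v) hA
  rw [vecMulVec_mul, trace_vecMulVec, smul_mul_assoc, one_mul, trace_smul, dotProduct_comm,
    ← dotProduct_mulVec] at this
  rwa [smul_mulVec, one_mulVec, dotProduct_smul, smul_eq_mul, mul_comm]

end LoewnerOrder

section SpectralNorm

variable {d : ℕ} {A B : Mat d}

theorem posDef_of_smul_one_le {c : ℝ} (hc : 0 < c) (h : c • 1 ≤ A) : A.PosDef :=
  posDef_of_le (PosDef.one.smul hc) h

theorem isHermitian_iff_isSymmetric_toEuclideanCLM :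
    A.IsHermitian ↔
      (toEuclideanCLM (n := Fin d) (𝕜 := ℝ) A : Vec d →ₗ[ℝ] Vec d).IsSymmetric :=
  isSymmetric_toEuclideanLin_iff.symm

theorem inner_toEuclideanCLM_smul_one (c : ℝ) (v : Vec d) :
    inner ℝ v (toEuclideanCLM (n := Fin d) (𝕜 := ℝ) (c • 1 : Mat d) v) = c * ‖v‖ ^ 2 := by
  rw [map_smul, map_one, _root_.smul_apply, one_apply_eq_self,
    inner_smul_right, real_inner_self_eq_norm_sq]

theorem le_iff_inner_toEuclideanCLM_le (hA : A.IsHermitian) (hB : B.IsHermitian) :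
    A ≤ B ↔ ∀ v : Vec d, inner ℝ v (toEuclideanCLM (n := Fin d) (𝕜 := ℝ) A v) ≤
      inner ℝ v (toEuclideanCLM (n := Fin d) (𝕜 := ℝ) B v) := by
  simp only [inner_toEuclideanCLM]
  exact ⟨fun h v => dotProduct_mulVec_le_of_le h v.ofLp,
    fun h => le_of_dotProduct_mulVec_le hA hB fun v => h (WithLp.toLp 2 v)⟩

theorem le_specNorm_smul_one (hA : A.IsHermitian) : A ≤ specNorm A • (1 : Mat d) := by
  refine (le_iff_inner_toEuclideanCLM_le hA (isHermitian_one.smul (.all _))).2 fun v => ?_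
  rw [inner_toEuclideanCLM_smul_one, sq, mul_left_comm]
  exact (real_inner_le_norm _ _).trans (by gcongr; exact ContinuousLinearMap.le_opNorm _ v)

theorem specNorm_le_trace (hA : 0 ≤ A) : specNorm A ≤ A.trace := by
  have hsymm := isHermitian_iff_isSymmetric_toEuclideanCLM.1 hA.posSemidef.1
  rw [specNorm, ContinuousLinearMap.norm_eq_iSup_rayleighQuotient _ hsymm]
  refine ciSup_le fun v => ?_
  have hle := (le_iff_inner_toEuclideanCLM_le hA.posSemidef.1
    (isHermitian_one.smul (.all _))).1 (le_trace_smul_one hA) v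
  have hnonneg : 0 ≤ inner ℝ v (toEuclideanCLM (n := Fin d) (𝕜 := ℝ) A v) := by
    rw [inner_toEuclideanCLM]
    exact hA.posSemidef.dotProduct_mulVec_nonneg v.ofLp
  rw [inner_toEuclideanCLM_smul_one] at hle
  rw [ContinuousLinearMap.rayleighQuotient, ContinuousLinearMap.reApplyInnerSelf_apply,
    real_inner_comm, RCLike.re_to_real, abs_of_nonneg (by positivity)]
  exact div_le_of_le_mul₀ (by positivity) hA.posSemidef.trace_nonneg hle

theorem le_smul_of_specNorm_sub_le {μ c : ℝ} (hμ : 0 < μ) (hA : A.IsHermitian)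
    (hB : μ • 1 ≤ B) (h : specNorm (A - B) ≤ c) : A ≤ (1 + c / μ) • B := by
  have hc : 0 ≤ c := (norm_nonneg _).trans h
  have hsub : A - B ≤ (c / μ) • B :=
    calc A - B ≤ specNorm (A - B) • 1 :=
          le_specNorm_smul_one (hA.sub (posDef_of_smul_one_le hμ hB).1)
      _ ≤ c • 1 := smul_le_smul_of_nonneg_right h zero_le_one
      _ = (c / μ) • μ • (1 : Mat d) := by rw [smul_smul, div_mul_cancel₀ _ hμ.ne']
      _ ≤ (c / μ) • B := smul_le_smul_of_nonneg_left hB (by positivity)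
  calc A = B + (A - B) := by abel
    _ ≤ B + (c / μ) • B := by gcongr
    _ = (1 + c / μ) • B := by rw [add_smul, one_smul]

end SpectralNorm

section HessianApproximationError

variable {d : ℕ} {B K H : Mat d}

theorem sigma_eq_trace_inv_mul (hK : K.IsHermitian) (B : Mat d) :
    sigma B K = (K⁻¹ * (B - K)).trace := by
  rw [sigma, ← conjTranspose_eq_transpose_of_trivial, hK.inv.eq]

theorem sigma_add_dim (hK : K.PosDef) (B : Mat d) : sigma B K + d = (K⁻¹ * B).trace := by
  rw [sigma_eq_trace_inv_mul hK.1, mul_sub, trace_sub, nonsing_inv_mul _ hK.det_pos.ne'.isUnit,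
    trace_one, Fintype.card_fin, sub_add_cancel]

theorem sigma_nonneg (hK : K.PosDef) (h : K ≤ B) : 0 ≤ sigma B K := by
  rw [sigma_eq_trace_inv_mul hK.1]
  exact trace_mul_nonneg hK.inv.posSemidef.nonneg (sub_nonneg.2 h)

theorem sigma_smul_smul (B K : Mat d) {c : ℝ} (hc : c ≠ 0) :
    sigma (c • B) (c • K) = sigma B K := by
  rw [sigma, sigma, inv_smul_of_ne_zero K hc, ← smul_sub, transpose_smul, smul_mul_smul_comm,
    inv_mul_cancel₀ hc, one_smul]

theorem sigma_add_dim_le_of_le_smul {a : ℝ} (ha : 0 < a) (hK : K.PosDef) (hH : H.PosDef)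
    (h : K ≤ a • H) (hB : 0 ≤ B) : sigma B H + d ≤ a * (sigma B K + d) := by
  have := trace_mul_le_trace_mul_of_le (inv_le_inv_of_le hK h) hB
  rw [inv_smul_of_ne_zero H ha.ne', smul_mul_assoc, trace_smul, smul_eq_mul, inv_mul_eq_div,
    div_le_iff₀' ha] at this
  rwa [sigma_add_dim hH, sigma_add_dim hK]

theorem trace_sub_le_mul_sigma {L : ℝ} (hL : 0 < L) (hK : K.PosDef) (hKL : K ≤ L • 1)
    (h : K ≤ B) : (B - K).trace ≤ L * sigma B K := by
  have := trace_mul_le_trace_mul_of_le (inv_le_inv_of_le hK hKL) (sub_nonneg.2 h)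
  rwa [inv_smul_of_ne_zero _ hL.ne', inv_one, smul_mul_assoc, one_mul, trace_smul, smul_eq_mul,
    ← sigma_eq_trace_inv_mul hK.1, inv_mul_eq_div, div_le_iff₀' hL] at this

theorem mul_sigma_le_trace_sub {μ : ℝ} (hμ : 0 < μ) (hKμ : μ • 1 ≤ K) (h : K ≤ B) :
    μ * sigma B K ≤ (B - K).trace := by
  have := trace_mul_le_trace_mul_of_le (inv_le_inv_of_le (PosDef.one.smul hμ) hKμ)
    (sub_nonneg.2 h)
  rwa [inv_smul_of_ne_zero _ hμ.ne', inv_one, smul_mul_assoc, one_mul, trace_smul, smul_eq_mul,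
    ← sigma_eq_trace_inv_mul (posDef_of_smul_one_le hμ hKμ).1, inv_mul_eq_div, le_div_iff₀' hμ]
    at this

theorem specNorm_sub_le_mul_sigma {L : ℝ} (hL : 0 < L) (hK : K.PosDef) (hKL : K ≤ L • 1)
    (h : K ≤ B) : specNorm (B - K) ≤ L * sigma B K :=
  (specNorm_le_trace (sub_nonneg.2 h)).trans (trace_sub_le_mul_sigma hL hK hKL h)

end HessianApproximationError

section BFGS

variable {d : ℕ} {B K : Mat d}

theorem bfgs_zero (B K : Mat d) : bfgs B K 0 = B := by
  simp [bfgs]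

theorem bfgs_eq (hB : B.IsHermitian) (hK : K.IsHermitian) (u : Fin d → ℝ) :
    bfgs B K u = B - (u ⬝ᵥ (B *ᵥ u))⁻¹ • vecMulVec (B *ᵥ u) (B *ᵥ u)
      + (u ⬝ᵥ (K *ᵥ u))⁻¹ • vecMulVec (K *ᵥ u) (K *ᵥ u) := by
  have mul_vecMulVec_mul {A : Mat d} (hA : A.IsHermitian) :
      A * vecMulVec u u * A = vecMulVec (A *ᵥ u) (A *ᵥ u) := by
    rw [mul_vecMulVec, vecMulVec_mul, ← mulVec_transpose,
      ← conjTranspose_eq_transpose_of_trivial, hA.eq]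
  rw [bfgs, mul_vecMulVec_mul hB, mul_vecMulVec_mul hK]

theorem isHermitian_bfgs (hB : B.IsHermitian) (hK : K.IsHermitian) (u : Fin d → ℝ) :
    (bfgs B K u).IsHermitian := by
  rw [bfgs_eq hB hK]
  exact (hB.sub ((posSemidef_vecMulVec_self_star (B *ᵥ u)).1.smul (.all _))).add
    ((posSemidef_vecMulVec_self_star (K *ᵥ u)).1.smul (.all _))

theorem dotProduct_bfgs_mulVec (hB : B.IsHermitian) (hK : K.IsHermitian) (u v : Fin d → ℝ) :
    v ⬝ᵥ (bfgs B K u *ᵥ v) = v ⬝ᵥ (B *ᵥ v) - (u ⬝ᵥ (B *ᵥ v)) ^ 2 / (u ⬝ᵥ (B *ᵥ u))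
      + (u ⬝ᵥ (K *ᵥ v)) ^ 2 / (u ⬝ᵥ (K *ᵥ u)) := by
  rw [bfgs_eq hB hK]
  simp only [add_mulVec, sub_mulVec, smul_mulVec, vecMulVec_mulVec, dotProduct_add,
    dotProduct_sub, dotProduct_smul, smul_eq_mul, op_smul_eq_smul]
  rw [dotProduct_comm (B *ᵥ u) v, dotProduct_comm (K *ᵥ u) v, dotProduct_mulVec_comm hB v u,
    dotProduct_mulVec_comm hK v u]
  ring

theorem trace_mul_bfgs (hB : B.IsHermitian) (hK : K.IsHermitian) (P : Mat d)
    (u : Fin d → ℝ) :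
    (P * bfgs B K u).trace = (P * B).trace
      - ((B *ᵥ u) ⬝ᵥ (P *ᵥ (B *ᵥ u))) / (u ⬝ᵥ (B *ᵥ u))
      + ((K *ᵥ u) ⬝ᵥ (P *ᵥ (K *ᵥ u))) / (u ⬝ᵥ (K *ᵥ u)) := by
  rw [bfgs_eq hB hK]
  simp only [mul_add, mul_sub, mul_smul_comm, mul_vecMulVec, trace_add, trace_sub, trace_smul,
    trace_vecMulVec, smul_eq_mul]
  rw [dotProduct_comm (B *ᵥ u), dotProduct_comm (K *ᵥ u), inv_mul_eq_div, inv_mul_eq_div]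

theorem le_bfgs (hK : K.PosDef) (h : K ≤ B) (u : Fin d → ℝ) : K ≤ bfgs B K u := by
  have hB := posDef_of_le hK h
  rcases eq_or_ne u 0 with rfl | hu
  · rwa [bfgs_zero]
  refine le_of_dotProduct_mulVec_le hK.1 (isHermitian_bfgs hB.1 hK.1 u) fun v => ?_
  have hb : 0 < u ⬝ᵥ (B *ᵥ u) := hB.dotProduct_mulVec_pos hu
  have hk : 0 < u ⬝ᵥ (K *ᵥ u) := hK.dotProduct_mulVec_pos hu
  have hle := dotProduct_mulVec_le_of_le h (v - (u ⬝ᵥ (B *ᵥ v) / u ⬝ᵥ (B *ᵥ u)) • u)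
  rw [dotProduct_mulVec_sub_smul hB.1, dotProduct_mulVec_sub_smul hK.1] at hle
  rw [dotProduct_bfgs_mulVec hB.1 hK.1]
  set b := u ⬝ᵥ (B *ᵥ u)
  set k := u ⬝ᵥ (K *ᵥ u)
  set x := u ⬝ᵥ (B *ᵥ v)
  set y := u ⬝ᵥ (K *ᵥ v)
  have hB_min : v ⬝ᵥ (B *ᵥ v) - 2 * (x / b) * x + (x / b) ^ 2 * b
      = v ⬝ᵥ (B *ᵥ v) - x ^ 2 / b := by field_simp; ring
  have hsq : 0 ≤ (x / b) ^ 2 * k - 2 * (x / b) * y + y ^ 2 / k :=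
    calc 0 ≤ k * (x / b - y / k) ^ 2 := by positivity
      _ = _ := by field_simp; ring
  linarith

theorem sigma_bfgs_le_sub (hK : K.PosDef) (h : K ≤ B) {u : Fin d → ℝ} (hu : u ≠ 0) :
    sigma (bfgs B K u) K ≤ sigma B K - ((u ⬝ᵥ (B *ᵥ u)) / (u ⬝ᵥ (K *ᵥ u)) - 1) := by
  have hB := posDef_of_le hK h
  have hb : 0 < u ⬝ᵥ (B *ᵥ u) := hB.dotProduct_mulVec_pos hu
  have hk : 0 < u ⬝ᵥ (K *ᵥ u) := hK.dotProduct_mulVec_pos hu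
  have hKu : K⁻¹ *ᵥ (K *ᵥ u) = u := by
    rw [mulVec_mulVec, nonsing_inv_mul _ hK.det_pos.ne'.isUnit, one_mulVec]
  have hcs := dotProduct_mulVec_sq_le hK.inv.posSemidef.nonneg (B *ᵥ u) (K *ᵥ u)
  rw [hKu, dotProduct_comm, dotProduct_comm (K *ᵥ u)] at hcs
  have htrace := trace_mul_bfgs hB.1 hK.1 K⁻¹ u
  rw [hKu, dotProduct_comm (K *ᵥ u), div_self hk.ne', ← sigma_add_dim hK,
    ← sigma_add_dim hK] at htrace
  have hratio : u ⬝ᵥ (B *ᵥ u) / u ⬝ᵥ (K *ᵥ u) ≤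
      (B *ᵥ u) ⬝ᵥ (K⁻¹ *ᵥ (B *ᵥ u)) / u ⬝ᵥ (B *ᵥ u) := by
    rw [div_le_div_iff₀ hk hb, ← sq]
    exact hcs
  linarith

theorem sigma_bfgs_le (hK : K.PosDef) (h : K ≤ B) (u : Fin d → ℝ) :
    sigma (bfgs B K u) K ≤ sigma B K := by
  rcases eq_or_ne u 0 with rfl | hu
  · rw [bfgs_zero]
  have := (one_le_div (hK.dotProduct_mulVec_pos hu)).2 (dotProduct_mulVec_le_of_le h u)
  rw [star_trivial] at this
  linarith [sigma_bfgs_le_sub hK h hu]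

theorem trace_sub_le_of_isGreedy {L : ℝ} (hK : K.PosDef) (hKL : K ≤ L • 1)
    (h : K ≤ B) {u : Fin d → ℝ} (hu : IsGreedy B K u) :
    (B - K).trace ≤ d * (L * ((u ⬝ᵥ (B *ᵥ u)) / (u ⬝ᵥ (K *ᵥ u)) - 1)) := by
  set r := u ⬝ᵥ (B *ᵥ u) / u ⬝ᵥ (K *ᵥ u)
  have hdiag (j : Fin d) : (B - K) j j ≤ L * (r - 1) := by
    have hr : B j j / K j j ≤ r := by
      simpa only [single_one_dotProduct, mulVec_single_one, col_apply] using hu.2 _ ⟨j, rfl⟩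
    have hKj : 0 < K j j := hK.diag_pos
    have hKL : K j j ≤ L := by
      simpa using (Matrix.le_iff.1 hKL).diag_nonneg (i := j)
    have hKB : K j j ≤ B j j := by
      simpa using (Matrix.le_iff.1 h).diag_nonneg (i := j)
    calc (B - K) j j = K j j * (B j j / K j j - 1) := by
          rw [Matrix.sub_apply]; field_simp
      _ ≤ L * (r - 1) := mul_le_mul hKL (by gcongr)
          (sub_nonneg.2 ((one_le_div hKj).2 hKB)) (hKj.le.trans hKL)
  calc (B - K).trace ≤ ∑ _ : Fin d, L * (r - 1) := sum_le_sum fun j _ => hdiag j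
    _ = d * (L * (r - 1)) := by simp

theorem sigma_bfgs_le_of_isGreedy [NeZero d] {μ L : ℝ} (hμ : 0 < μ) (hL : 0 < L)
    (hKμ : μ • 1 ≤ K) (hKL : K ≤ L • 1) (h : K ≤ B) {u : Fin d → ℝ} (hu : IsGreedy B K u) :
    sigma (bfgs B K u) K ≤ (1 - μ / (d * L)) * sigma B K := by
  have hK := posDef_of_smul_one_le hμ hKμ
  have hd : (0 : ℝ) < d := by exact_mod_cast NeZero.pos d
  have hu0 : u ≠ 0 := by
    obtain ⟨⟨k, rfl⟩, -⟩ := hu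
    exact Pi.single_ne_zero_iff.2 one_ne_zero
  have hdecrease := sigma_bfgs_le_sub hK h hu0
  have hsigma : μ / (d * L) * sigma B K ≤ (u ⬝ᵥ (B *ᵥ u)) / (u ⬝ᵥ (K *ᵥ u)) - 1 := by
    rw [div_mul_eq_mul_div, div_le_iff₀' (by positivity), mul_assoc]
    exact (mul_sigma_le_trace_sub hμ hKμ h).trans (trace_sub_le_of_isGreedy hK hKL h hu)
  linarith

end BFGS

section SecantUpdate

variable {d : ℕ} {D K H H' : Mat d} {a : ℝ}

theorem smul_le_of_sq_smul_le (ha : 0 ≤ a) (hKH : K ≤ a • H) (h : a ^ 2 • H ≤ D) : a • K ≤ D :=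
  calc a • K ≤ a • a • H := smul_le_smul_of_nonneg_left hKH ha
    _ = a ^ 2 • H := by rw [smul_smul, sq]
    _ ≤ D := h

theorem sigma_add_dim_bfgs_smul_le (ha : 0 < a) (hK : K.PosDef) (hH : H.PosDef)
    (hH' : H'.PosDef) (hKH : K ≤ a • H) (hHK : H ≤ a • K) (hKH' : K ≤ a • H')
    (h : a ^ 2 • H ≤ D) (v : Fin d → ℝ) :
    sigma (bfgs D (a • K) v) H' + d ≤ a ^ 4 * (sigma D (a ^ 2 • H) + d) := by
  have haK := hK.smul ha
  have hKD := smul_le_of_sq_smul_le ha.le hKH h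
  have hD := (posDef_of_le haK hKD).posSemidef.nonneg
  have hQ := (posDef_of_le haK (le_bfgs haK hKD v)).posSemidef.nonneg
  have ha2 : 0 < a ^ 2 := by positivity
  calc sigma (bfgs D (a • K) v) H' + d ≤ a ^ 2 * (sigma (bfgs D (a • K) v) (a • K) + d) :=
        sigma_add_dim_le_of_le_smul ha2 haK hH' (smul_le_of_sq_smul_le ha.le hKH' le_rfl) hQ
    _ ≤ a ^ 2 * (sigma D (a • K) + d) := by
        gcongr
        exact sigma_bfgs_le haK hKD v
    _ ≤ a ^ 2 * (a ^ 2 * (sigma D (a ^ 2 • H) + d)) := by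
        gcongr
        exact sigma_add_dim_le_of_le_smul ha2 (hH.smul ha2) haK
          (smul_le_smul_of_nonneg_left hHK ha2.le) hD
    _ = a ^ 4 * (sigma D (a ^ 2 • H) + d) := by ring

end SecantUpdate

section Gradient

variable {E : Type*} [NormedAddCommGroup E] [InnerProductSpace ℝ E]

theorem mul_norm_sq_le_inner_of_hasFDerivAt {g : E → E} {g' : E →L[ℝ] E} {x : E} {c : ℝ}
    (hg : HasFDerivAt g g' x) (h : ∀ y, c * ‖y - x‖ ^ 2 ≤ inner ℝ (g y - g x) (y - x)) (v : E) :
    c * ‖v‖ ^ 2 ≤ inner ℝ v (g' v) := by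
  refine ge_of_tendsto (tendsto_const_nhds.inner (hg.hasLineDerivAt v).tendsto_slope_zero_right) ?_
  filter_upwards [self_mem_nhdsWithin] with t (ht : 0 < t)
  have := h (x + t • v)
  rw [add_sub_cancel_left, norm_smul, mul_pow, Real.norm_eq_abs, sq_abs, real_inner_smul_right,
    mul_left_comm, sq t, mul_assoc, mul_le_mul_iff_of_pos_left ht] at this
  rwa [real_inner_comm, real_inner_smul_left, inv_mul_eq_div, le_div_iff₀' ht]

variable [CompleteSpace E] {f : E → ℝ}

theorem contDiff_gradient (hf : ContDiff ℝ 2 f) : ContDiff ℝ 1 (gradient f) :=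
  (InnerProductSpace.toDual ℝ E).symm.contDiff.comp (hf.fderiv_right (by norm_num))

theorem hasFDerivAt_gradient (hf : ContDiff ℝ 2 f) (x : E) :
    HasFDerivAt (gradient f) (fderiv ℝ (gradient f) x) x :=
  ((contDiff_gradient hf).differentiable one_ne_zero x).hasFDerivAt

theorem isSymmetric_fderiv_gradient (hf : ContDiff ℝ 2 f) (x : E) :
    (fderiv ℝ (gradient f) x : E →ₗ[ℝ] E).IsSymmetric := by
  have hinner (v w : E) :
      inner ℝ (fderiv ℝ (gradient f) x v) w = fderiv ℝ (fderiv ℝ f) x v w := by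
    have hleft := (hasFDerivAt_gradient hf x).inner ℝ (hasFDerivAt_const w x)
    have hright := ((hf.fderiv_right (m := 1) (by norm_num)).differentiable one_ne_zero
      x).hasFDerivAt.clm_apply (hasFDerivAt_const w x)
    simp only [inner_gradient_left] at hleft
    simpa using DFunLike.congr_fun (hleft.unique hright) v
  intro v w
  have hsymm : IsSymmSndFDerivAt ℝ f x := hf.contDiffAt.isSymmSndFDerivAt (by simp)
  calc _ = fderiv ℝ (fderiv ℝ f) x v w := hinner v w
    _ = fderiv ℝ (fderiv ℝ f) x w v := hsymm v w
    _ = _ := by rw [← hinner, real_inner_comm]; rfl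

theorem sum_gradient_eq_zero_of_isLocalMin {ι : Type*} {s : Finset ι} {f : ι → E → ℝ} {x : E}
    (hf : ∀ i ∈ s, DifferentiableAt ℝ (f i) x) (hx : IsLocalMin (fun y => ∑ i ∈ s, f i y) x) :
    ∑ i ∈ s, gradient (f i) x = 0 := by
  apply (InnerProductSpace.toDual ℝ E).injective
  rw [map_sum, map_zero, ← hx.fderiv_eq_zero, fderiv_fun_sum hf]
  exact sum_congr rfl fun i _ => toDual_gradient

end Gradient

section Hessian

variable {d : ℕ} {f : Vec d → ℝ} {μ L Lt : ℝ}

theorem toEuclideanCLM_hess (f : Vec d → ℝ) (x : Vec d) :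
    toEuclideanCLM (n := Fin d) (𝕜 := ℝ) (hess f x) = fderiv ℝ (gradient f) x := by
  apply ContinuousLinearMap.coe_injective
  refine (EuclideanSpace.basisFun (Fin d) ℝ).toBasis.ext fun j => ?_
  ext i
  simp [hess]

theorem isHermitian_hess (hf : ContDiff ℝ 2 f) (x : Vec d) : (hess f x).IsHermitian := by
  rw [isHermitian_iff_isSymmetric_toEuclideanCLM, toEuclideanCLM_hess]
  exact isSymmetric_fderiv_gradient hf x

theorem StronglyConvex.mul_norm_sq_le_inner_gradient_sub (h : StronglyConvex μ f) (x y : Vec d) :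
    μ * ‖y - x‖ ^ 2 ≤ inner ℝ (gradient f y - gradient f x) (y - x) := by
  have hxy := h x y
  have hyx := h y x
  rw [norm_sub_rev, ← neg_sub y x, inner_neg_right] at hyx
  rw [inner_sub_left]
  linarith

theorem Smooth.inner_gradient_sub_le (h : Smooth L f) (x y : Vec d) :
    inner ℝ (gradient f y - gradient f x) (y - x) ≤ L * ‖y - x‖ ^ 2 := by
  have hxy := h x y
  have hyx := h y x
  rw [norm_sub_rev, ← neg_sub y x, inner_neg_right] at hyx
  rw [inner_sub_left]
  linarith

theorem StronglyConvex.smul_one_le_hess (h : StronglyConvex μ f) (hf : ContDiff ℝ 2 f)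
    (x : Vec d) : μ • 1 ≤ hess f x := by
  refine (le_iff_inner_toEuclideanCLM_le (isHermitian_one.smul (.all _))
    (isHermitian_hess hf x)).2 fun v => ?_
  rw [inner_toEuclideanCLM_smul_one, toEuclideanCLM_hess]
  exact mul_norm_sq_le_inner_of_hasFDerivAt (hasFDerivAt_gradient hf x)
    (h.mul_norm_sq_le_inner_gradient_sub x) v

theorem Smooth.hess_le_smul_one (h : Smooth L f) (hf : ContDiff ℝ 2 f) (x : Vec d) :
    hess f x ≤ L • 1 := by
  refine (le_iff_inner_toEuclideanCLM_le (isHermitian_hess hf x)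
    (isHermitian_one.smul (.all _))).2 fun v => ?_
  rw [inner_toEuclideanCLM_smul_one, toEuclideanCLM_hess]
  have := mul_norm_sq_le_inner_of_hasFDerivAt (c := -L) (hasFDerivAt_gradient hf x).neg
    (fun y => ?_) v
  · rwa [_root_.neg_apply, inner_neg_right, neg_mul, neg_le_neg_iff] at this
  · rw [Pi.neg_apply, Pi.neg_apply, ← neg_sub', inner_neg_left, neg_mul, neg_le_neg_iff]
    exact h.inner_gradient_sub_le x y

theorem StronglyConvex.le_of_smooth [NeZero d] (hconv : StronglyConvex μ f)
    (hsmooth : Smooth L f) : μ ≤ L := by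
  let e : Vec d := EuclideanSpace.single 0 1
  have := (hconv.mul_norm_sq_le_inner_gradient_sub 0 e).trans (hsmooth.inner_gradient_sub_le 0 e)
  simpa [e] using this

theorem LipschitzHessian.nonneg [NeZero d] (h : LipschitzHessian Lt f) : 0 ≤ Lt := by
  simpa using (norm_nonneg _).trans (h 0 (EuclideanSpace.single 0 1))

theorem LipschitzHessian.norm_gradient_sub_sub_le (hLip : LipschitzHessian Lt f)
    (hf : ContDiff ℝ 2 f) (hLt : 0 ≤ Lt) (z y : Vec d) :
    ‖gradient f z - gradient f y - toEuclideanCLM (n := Fin d) (𝕜 := ℝ) (hess f z) (z - y)‖ ≤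
      Lt * ‖z - y‖ ^ 2 := by
  have hfderiv : ∀ x ∈ Metric.closedBall z ‖z - y‖,
      ‖fderiv ℝ (gradient f) x - toEuclideanCLM (n := Fin d) (𝕜 := ℝ) (hess f z)‖ ≤
        Lt * ‖z - y‖ := fun x hx => by
    rw [← toEuclideanCLM_hess, ← map_sub]
    exact (hLip z x).trans (by gcongr; exact mem_closedBall_iff_norm.1 hx)
  have := (convex_closedBall z ‖z - y‖).norm_image_sub_le_of_norm_fderiv_le'
    (fun x _ => (hasFDerivAt_gradient hf x).differentiableAt) hfderiv
    (mem_closedBall_iff_norm'.2 le_rfl) (Metric.mem_closedBall_self (norm_nonneg _))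
  rwa [mul_assoc, ← sq] at this

end Hessian

section AveragedHessian

variable {d : ℕ} {f : Vec d → ℝ} {μ Lt : ℝ}

theorem continuous_fderiv_gradient_segment (hf : ContDiff ℝ 2 f) (z z' : Vec d) :
    Continuous fun τ : ℝ => fderiv ℝ (gradient f) (z + τ • (z' - z)) :=
  ((contDiff_gradient hf).continuous_fderiv one_ne_zero).comp (by fun_prop)

theorem toEuclideanCLM_avgHess (hf : ContDiff ℝ 2 f) (z z' : Vec d) :
    toEuclideanCLM (n := Fin d) (𝕜 := ℝ) (avgHess f z z') =
      ∫ τ in (0 : ℝ)..1, fderiv ℝ (gradient f) (z + τ • (z' - z)) := by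
  have hcont := continuous_fderiv_gradient_segment hf z z'
  apply ContinuousLinearMap.coe_injective
  refine (EuclideanSpace.basisFun (Fin d) ℝ).toBasis.ext fun j => ?_
  ext i
  have hcont_apply := hcont.clm_apply (continuous_const (y := EuclideanSpace.single j 1))
  have hproj := (EuclideanSpace.proj i : Vec d →L[ℝ] ℝ).intervalIntegral_comp_comm
    (hcont_apply.intervalIntegrable (μ := MeasureTheory.volume) 0 1)
  rw [← ContinuousLinearMap.intervalIntegral_apply (hcont.intervalIntegrable 0 1)] at hproj
  simpa [avgHess, hess] using hproj

theorem avgHess_comm (f : Vec d → ℝ) (z z' : Vec d) : avgHess f z z' = avgHess f z' z := by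
  ext i j
  have hreverse (τ : ℝ) : z' + τ • (z - z') = z + (1 - τ) • (z' - z) := by module
  simp only [avgHess, of_apply, hreverse]
  rw [intervalIntegral.integral_comp_sub_left (fun τ => hess f (z + τ • (z' - z)) i j), sub_self,
    sub_zero]

theorem isHermitian_avgHess (hf : ContDiff ℝ 2 f) (z z' : Vec d) :
    (avgHess f z z').IsHermitian := by
  ext i j
  simp only [conjTranspose_apply, star_trivial, avgHess, of_apply]
  congr! 2 with τ
  exact (isHermitian_hess hf _).apply i j

theorem StronglyConvex.smul_one_le_avgHess (h : StronglyConvex μ f) (hf : ContDiff ℝ 2 f)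
    (z z' : Vec d) : μ • 1 ≤ avgHess f z z' := by
  refine (le_iff_inner_toEuclideanCLM_le (isHermitian_one.smul (.all _))
    (isHermitian_avgHess hf z z')).2 fun v => ?_
  have hcont := continuous_fderiv_gradient_segment hf z z'
  have hcont_apply := hcont.clm_apply (continuous_const (y := v))
  rw [inner_toEuclideanCLM_smul_one, toEuclideanCLM_avgHess hf,
    ContinuousLinearMap.intervalIntegral_apply (hcont.intervalIntegrable 0 1),
    ← innerSL_apply_apply ℝ,
    ← ContinuousLinearMap.intervalIntegral_comp_comm _ (hcont_apply.intervalIntegrable 0 1)]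
  calc μ * ‖v‖ ^ 2 = ∫ _ in (0 : ℝ)..1, μ * ‖v‖ ^ 2 := by simp
    _ ≤ _ := intervalIntegral.integral_mono_on zero_le_one (by simp)
      ((continuous_const.inner hcont_apply).intervalIntegrable 0 1) fun τ _ =>
        mul_norm_sq_le_inner_of_hasFDerivAt (hasFDerivAt_gradient hf _)
          (h.mul_norm_sq_le_inner_gradient_sub _) v

theorem LipschitzHessian.specNorm_avgHess_sub_hess_le (hLip : LipschitzHessian Lt f)
    (hf : ContDiff ℝ 2 f) (z z' : Vec d) :
    specNorm (avgHess f z z' - hess f z) ≤ Lt * ‖z' - z‖ / 2 := by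
  have hcont := continuous_fderiv_gradient_segment hf z z'
  rw [specNorm, map_sub, toEuclideanCLM_avgHess hf]
  calc _ = ‖∫ τ in (0 : ℝ)..1, toEuclideanCLM (n := Fin d) (𝕜 := ℝ)
          (hess f (z + τ • (z' - z)) - hess f z)‖ := by
        simp only [map_sub, toEuclideanCLM_hess]
        rw [intervalIntegral.integral_sub (hcont.intervalIntegrable _ _) (by simp)]
        simp
    _ ≤ ∫ τ in (0 : ℝ)..1, τ * (Lt * ‖z' - z‖) := by
        refine intervalIntegral.norm_integral_le_of_norm_le zero_le_one
          (.of_forall fun τ hτ => (hLip z _).trans_eq ?_)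
          (Continuous.intervalIntegrable (by fun_prop) _ _)
        rw [add_sub_cancel_left, norm_smul, Real.norm_of_nonneg hτ.1.le, mul_left_comm]
    _ = Lt * ‖z' - z‖ / 2 := by
        rw [intervalIntegral.integral_mul_const, integral_id]
        ring

end AveragedHessian

section HessianComparison

variable {d : ℕ} {f : Vec d → ℝ} {μ Lt a : ℝ} {z z' : Vec d}

theorem avgHess_le_smul_hess (hμ : 0 < μ) (hf : ContDiff ℝ 2 f) (hconv : StronglyConvex μ f)
    (hLip : LipschitzHessian Lt f) (ha : 1 + Lt * ‖z' - z‖ / 2 / μ ≤ a) :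
    avgHess f z z' ≤ a • hess f z := by
  have hH := hconv.smul_one_le_hess hf z
  refine (le_smul_of_specNorm_sub_le hμ (isHermitian_avgHess hf z z') hH
    (hLip.specNorm_avgHess_sub_hess_le hf z z')).trans ?_
  have := (posDef_of_smul_one_le hμ hH).posSemidef.nonneg
  gcongr

theorem hess_le_smul_avgHess (hμ : 0 < μ) (hf : ContDiff ℝ 2 f) (hconv : StronglyConvex μ f)
    (hLip : LipschitzHessian Lt f) (ha : 1 + Lt * ‖z' - z‖ / 2 / μ ≤ a) :
    hess f z ≤ a • avgHess f z z' := by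
  have hK := hconv.smul_one_le_avgHess hf z z'
  have hdist : specNorm (hess f z - avgHess f z z') ≤ Lt * ‖z' - z‖ / 2 := by
    rw [specNorm, map_sub, norm_sub_rev, ← map_sub]
    exact hLip.specNorm_avgHess_sub_hess_le hf z z'
  refine (le_smul_of_specNorm_sub_le hμ (isHermitian_hess hf z) hK hdist).trans ?_
  have := (posDef_of_smul_one_le hμ hK).posSemidef.nonneg
  gcongr

end HessianComparison

section QuasiNewtonStep

variable {d : ℕ}

theorem mul_norm_le_norm_toEuclideanLin {S : Mat d} {c : ℝ} (hc : 0 < c) (hS : c • 1 ≤ S)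
    (v : Vec d) : c * ‖v‖ ≤ ‖toEuclideanLin S v‖ := by
  rcases eq_or_ne v 0 with rfl | hv
  · simp
  refine le_of_mul_le_mul_left ?_ (norm_pos_iff.2 hv)
  have := (le_iff_inner_toEuclideanCLM_le (isHermitian_one.smul (.all _))
    (posDef_of_smul_one_le hc hS).1).1 hS v
  rw [inner_toEuclideanCLM_smul_one] at this
  calc ‖v‖ * (c * ‖v‖) = c * ‖v‖ ^ 2 := by ring
    _ ≤ _ := this.trans (real_inner_le_norm _ _)

theorem toEuclideanLin_inv_apply_cancel {S : Mat d} (hS : IsUnit S.det) (v : Vec d) :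
    toEuclideanLin S (toEuclideanLin S⁻¹ v) = v := by
  simp only [toLpLin_apply, mulVec_mulVec, mul_nonsing_inv _ hS, one_mulVec, WithLp.toLp_ofLp]

theorem norm_inv_sum_sub_le {ι : Type*} [Fintype ι] [Nonempty ι] {D : ι → Mat d}
    {z g g' : ι → Vec d} {y : Vec d} {μ r : ℝ} (hμ : 0 < μ) (hD : ∀ i, μ • 1 ≤ D i)
    (hg' : ∑ i, g' i = 0)
    (h : ∀ i, ‖toEuclideanLin (D i) (z i - y) - (g i - g' i)‖ ≤ μ * r) :
    ‖toEuclideanLin (∑ i, D i)⁻¹ (∑ i, (toEuclideanLin (D i) (z i) - g i)) - y‖ ≤ r := by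
  have hcard : (0 : ℝ) < Fintype.card ι := by exact_mod_cast Fintype.card_pos
  have hS : (Fintype.card ι * μ) • 1 ≤ ∑ i, D i :=
    calc (Fintype.card ι * μ) • (1 : Mat d) = ∑ _ : ι, μ • 1 := by
          rw [sum_const, card_univ, mul_smul, Nat.cast_smul_eq_nsmul]
      _ ≤ ∑ i, D i := sum_le_sum fun i _ => hD i
  have hdet := (posDef_of_smul_one_le (mul_pos hcard hμ) hS).det_pos.ne'.isUnit
  set w := toEuclideanLin (∑ i, D i)⁻¹ (∑ i, (toEuclideanLin (D i) (z i) - g i)) - y with hw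
  have hsum : toEuclideanLin (∑ i, D i) w =
      ∑ i, (toEuclideanLin (D i) (z i - y) - (g i - g' i)) := by
    rw [hw, map_sub, toEuclideanLin_inv_apply_cancel hdet, map_sum, LinearMap.sum_apply]
    simp only [map_sub, sum_sub_distrib, hg']
    abel
  refine le_of_mul_le_mul_left ?_ (mul_pos hcard hμ)
  calc Fintype.card ι * μ * ‖w‖ ≤ ‖toEuclideanLin (∑ i, D i) w‖ :=
        mul_norm_le_norm_toEuclideanLin (mul_pos hcard hμ) hS w
    _ ≤ ∑ _ : ι, μ * r := by
        rw [hsum]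
        exact (norm_sum_le _ _).trans (sum_le_sum fun i _ => h i)
    _ = Fintype.card ι * μ * r := by
        rw [sum_const, card_univ, nsmul_eq_mul, mul_assoc]

end QuasiNewtonStep

section Control

theorem one_sub_div_nonneg {d : ℕ} [NeZero d] {μ L : ℝ} (hμ : 0 < μ) (hμL : μ ≤ L) :
    0 ≤ 1 - μ / (d * L) := by
  have hd : (1 : ℝ) ≤ d := by exact_mod_cast NeZero.one_le
  rw [sub_nonneg]
  exact div_le_one_of_le₀ (hμL.trans (le_mul_of_one_le_left (hμ.le.trans hμL) hd))
    (mul_nonneg d.cast_nonneg (hμ.le.trans hμL))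

variable {d : ℕ} {f : Vec d → ℝ} {xstar z z' : Vec d} {μ L Lt s a e e' r r' : ℝ} {D : Mat d}

/-- The assumptions of the method on a single component function, bundled. -/
structure IsRegular (μ L Lt : ℝ) (f : Vec d → ℝ) : Prop where
  contDiff : ContDiff ℝ 2 f
  stronglyConvex : StronglyConvex μ f
  smooth : Smooth L f
  lipschitzHessian : LipschitzHessian Lt f

/-- Invariant of one component of the method: `D` dominates `s ∇²f(z)` with error at most `e`,
measured by `σ`, and `z` has distance at most `r` from `xstar`. -/
structure Controlled (f : Vec d → ℝ) (xstar : Vec d) (s e r : ℝ) (z : Vec d) (D : Mat d) :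
    Prop where
  smul_hess_le : s • hess f z ≤ D
  sigma_le : sigma D (s • hess f z) ≤ e
  norm_le : ‖z - xstar‖ ≤ r

theorem IsRegular.posDef_hess (hR : IsRegular μ L Lt f) (hμ : 0 < μ) (x : Vec d) :
    (hess f x).PosDef :=
  posDef_of_smul_one_le hμ (hR.stronglyConvex.smul_one_le_hess hR.contDiff x)

theorem Controlled.mono (h : Controlled f xstar s e r z D) (he : e ≤ e') (hr : r ≤ r') :
    Controlled f xstar s e' r' z D :=
  ⟨h.smul_hess_le, h.sigma_le.trans he, h.norm_le.trans hr⟩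

theorem Controlled.smul (h : Controlled f xstar 1 e r z D) {w : ℝ} (hw : 0 < w) :
    Controlled f xstar w e r z (w • D) := by
  obtain ⟨hle, hsigma, hr⟩ := h
  rw [one_smul] at hle hsigma
  exact ⟨smul_le_smul_of_nonneg_left hle hw.le, by rwa [sigma_smul_smul _ _ hw.ne'], hr⟩

theorem Controlled.hess_le (h : Controlled f xstar s e r z D) (hH : (hess f z).PosDef)
    (hs : 1 ≤ s) : hess f z ≤ D :=
  calc hess f z = (1 : ℝ) • hess f z := (one_smul _ _).symm
    _ ≤ s • hess f z := smul_le_smul_of_nonneg_right hs hH.posSemidef.nonneg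
    _ ≤ D := h.smul_hess_le

theorem Controlled.sigma_hess_le (h : Controlled f xstar s e r z D) (hH : (hess f z).PosDef)
    (hs : 1 ≤ s) (hsa : s ≤ a) : sigma D (hess f z) ≤ a * (d + e) - d := by
  have hs0 : 0 < s := one_pos.trans_le hs
  have hD : 0 ≤ D := (posDef_of_le hH (h.hess_le hH hs)).posSemidef.nonneg
  have hsigma := sigma_nonneg (hH.smul hs0) h.smul_hess_le
  have := calc sigma D (hess f z) + d
      ≤ s * (sigma D (s • hess f z) + d) :=
        sigma_add_dim_le_of_le_smul hs0 (hH.smul hs0) hH le_rfl hD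
    _ ≤ a * (e + d) := by
        gcongr
        · exact hs0.le.trans hsa
        · exact h.sigma_le
  linarith

theorem Controlled.norm_residual_le [NeZero d] (h : Controlled f xstar s e r z D)
    (hR : IsRegular μ L Lt f) (hμ : 0 < μ) (hs : 1 ≤ s) (hsa : s ≤ a) :
    ‖toEuclideanLin D (z - xstar) - (gradient f z - gradient f xstar)‖ ≤
      (L * (a * (d + e) - d) + Lt * r) * r := by
  have hL : 0 < L := hμ.trans_le (hR.stronglyConvex.le_of_smooth hR.smooth)
  have hLt := hR.lipschitzHessian.nonneg
  have hH := hR.posDef_hess hμ z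
  have hnorm : specNorm (D - hess f z) ≤ L * (a * (d + e) - d) :=
    (specNorm_sub_le_mul_sigma hL hH (hR.smooth.hess_le_smul_one hR.contDiff z)
      (h.hess_le hH hs)).trans (by gcongr; exact h.sigma_hess_le hH hs hsa)
  have hsplit : toEuclideanLin D (z - xstar) - (gradient f z - gradient f xstar) =
      toEuclideanCLM (n := Fin d) (𝕜 := ℝ) (D - hess f z) (z - xstar) -
        (gradient f z - gradient f xstar -
          toEuclideanCLM (n := Fin d) (𝕜 := ℝ) (hess f z) (z - xstar)) := by
    rw [map_sub (toEuclideanCLM (n := Fin d) (𝕜 := ℝ)), _root_.sub_apply, sub_sub_sub_cancel_right]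
    rfl
  rw [hsplit]
  calc _ ≤ specNorm (D - hess f z) * ‖z - xstar‖ + Lt * ‖z - xstar‖ ^ 2 :=
        (norm_sub_le _ _).trans (add_le_add (ContinuousLinearMap.le_opNorm _ _)
          (hR.lipschitzHessian.norm_gradient_sub_sub_le hR.contDiff hLt z xstar))
    _ ≤ L * (a * (d + e) - d) * r + Lt * r ^ 2 := by
        gcongr
        · exact (norm_nonneg _).trans hnorm
        · exact h.norm_le
        · exact h.norm_le
    _ = _ := by ring

theorem Controlled.bfgs_bfgs [NeZero d] {v u : Fin d → ℝ}
    (h : Controlled f xstar (a ^ 2) e r z D) (hR : IsRegular μ L Lt f) (hμ : 0 < μ)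
    (hz' : ‖z' - xstar‖ ≤ r') (ha : 1 + Lt * ‖z' - z‖ / 2 / μ ≤ a)
    (hu : IsGreedy (bfgs D (a • avgHess f z z') v) (hess f z') u) :
    Controlled f xstar 1 ((1 - μ / (d * L)) * (a ^ 4 * (d + e) - d)) r' z'
      (bfgs (bfgs D (a • avgHess f z z') v) (hess f z') u) := by
  have hH := hR.posDef_hess hμ z
  have hH' := hR.posDef_hess hμ z'
  obtain ⟨hf, hconv, hsmooth, hLip⟩ := hR
  have hμL := hconv.le_of_smooth hsmooth
  have hL : 0 < L := hμ.trans_le hμL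
  have ha0 : 0 < a := by
    have := hLip.nonneg
    exact lt_of_lt_of_le (by positivity) ha
  have hK := posDef_of_smul_one_le hμ (hconv.smul_one_le_avgHess hf z z')
  have hKH := avgHess_le_smul_hess hμ hf hconv hLip ha
  have hHK := hess_le_smul_avgHess hμ hf hconv hLip ha
  rw [norm_sub_rev] at ha
  have hKH' := avgHess_le_smul_hess hμ hf hconv hLip ha
  have hHK' := hess_le_smul_avgHess hμ hf hconv hLip ha
  rw [avgHess_comm] at hKH' hHK'
  have hQ : hess f z' ≤ bfgs D (a • avgHess f z z') v :=
    hHK'.trans (le_bfgs (hK.smul ha0) (smul_le_of_sq_smul_le ha0.le hKH h.smul_hess_le) v)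
  have hsecant := sigma_add_dim_bfgs_smul_le ha0 hK hH hH' hKH hHK hKH' h.smul_hess_le v
  refine ⟨by simpa using le_bfgs hH' hQ u, ?_, hz'⟩
  rw [one_smul]
  calc _ ≤ (1 - μ / (d * L)) * sigma (bfgs D (a • avgHess f z z') v) (hess f z') :=
        sigma_bfgs_le_of_isGreedy hμ hL (hconv.smul_one_le_hess hf z')
          (hsmooth.hess_le_smul_one hf z') hQ hu
    _ ≤ (1 - μ / (d * L)) * (a ^ 4 * (d + e) - d) := by
        refine mul_le_mul_of_nonneg_left ?_ (one_sub_div_nonneg hμ hμL)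
        have : a ^ 4 * (sigma D (a ^ 2 • hess f z) + d) ≤ a ^ 4 * (e + d) := by
          gcongr
          exact h.sigma_le
        linarith

end Control

section Epoch

variable {n d : ℕ} {μ L Lt : ℝ} {f : Fin n → Vec d → ℝ} {xstar : Vec d}
  {α e η : ℕ → ℝ} {k j : ℕ} {z : Fin n → Vec d} {D : Fin n → Mat d}

/-- Sequences `e` and `η` that bound, epoch by epoch, the errors of the Hessian approximations and
the distances of the iterates to the minimizer, for the correction factors `α`. -/
structure IsMajorant (μ L Lt : ℝ) (d : ℕ) (α e η : ℕ → ℝ) : Prop where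
  antitone_error : Antitone e
  antitone_radius : Antitone η
  radius_nonneg : ∀ k, 0 ≤ η k
  div_le_factor : ∀ k, Lt * η k / μ ≤ α k
  error_succ : ∀ k, (1 - μ / (d * L)) * ((1 + α k) ^ 4 * (d + e k) - d) ≤ e (k + 1)
  radius_succ : ∀ k, (L * ((1 + α k) ^ 2 * (d + e k) - d) + Lt * η k) * η k ≤ μ * η (k + 1)

/-- Invariant of the method after `j` steps of epoch `k`: the components below `j` have already
been updated and are not yet rescaled. -/
structure EpochState (f : Fin n → Vec d → ℝ) (xstar : Vec d) (α e η : ℕ → ℝ) (k j : ℕ)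
    (z : Fin n → Vec d) (D : Fin n → Mat d) : Prop where
  updated : ∀ i : Fin n, i.1 < j → Controlled (f i) xstar 1 (e (k + 1)) (η (k + 1)) (z i) (D i)
  pending : ∀ i : Fin n, j ≤ i.1 →
    Controlled (f i) xstar ((1 + α k) ^ 2) (e k) (η k) (z i) (D i)

theorem IsMajorant.factor_nonneg (hM : IsMajorant μ L Lt d α e η) (hμ : 0 < μ) (hLt : 0 ≤ Lt)
    (k : ℕ) : 0 ≤ α k :=
  (div_nonneg (mul_nonneg hLt (hM.radius_nonneg k)) hμ.le).trans (hM.div_le_factor k)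

theorem EpochState.exists_controlled (h : EpochState f xstar α e η k j z D)
    (hM : IsMajorant μ L Lt d α e η) (hα : 0 ≤ α k) (i : Fin n) :
    ∃ s, 1 ≤ s ∧ s ≤ (1 + α k) ^ 2 ∧ Controlled (f i) xstar s (e k) (η k) (z i) (D i) := by
  have hone : 1 ≤ (1 + α k) ^ 2 := one_le_pow₀ (le_add_of_nonneg_right hα)
  rcases lt_or_ge i.1 j with hij | hij
  · exact ⟨1, le_rfl, hone, (h.updated i hij).mono (hM.antitone_error k.le_succ)
      (hM.antitone_radius k.le_succ)⟩
  · exact ⟨_, hone, le_rfl, h.pending i hij⟩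

theorem EpochState.norm_newton_sub_le [NeZero n] [NeZero d]
    (h : EpochState f xstar α e η k j z D)
    (hM : IsMajorant μ L Lt d α e η) (hμ : 0 < μ) (hR : ∀ i, IsRegular μ L Lt (f i))
    (hgrad : ∑ i, gradient (f i) xstar = 0) :
    ‖toEuclideanLin (∑ i, D i)⁻¹ (∑ i, (toEuclideanLin (D i) (z i) - gradient (f i) (z i))) -
      xstar‖ ≤ η (k + 1) := by
  have hα := hM.factor_nonneg hμ (hR 0).lipschitzHessian.nonneg k
  choose s hs hsa hC using h.exists_controlled hM hα
  refine norm_inv_sum_sub_le hμ (fun i => ?_) hgrad fun i =>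
    ((hC i).norm_residual_le (hR i) hμ (hs i) (hsa i)).trans (hM.radius_succ k)
  exact ((hR i).stronglyConvex.smul_one_le_hess (hR i).contDiff (z i)).trans
    ((hC i).hess_le ((hR i).posDef_hess hμ (z i)) (hs i))

theorem EpochState.update {i : Fin n} (h : EpochState f xstar α e η k i z D) {z' : Vec d}
    {D' : Mat d} (hi : Controlled (f i) xstar 1 (e (k + 1)) (η (k + 1)) z' D') :
    EpochState f xstar α e η k (i + 1) (Function.update z i z') (Function.update D i D') := by
  refine ⟨fun l hl => ?_, fun l hl => ?_⟩
  · rcases eq_or_ne l i with rfl | hli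
    · simpa using hi
    · simpa [hli] using h.updated l (by omega)
  · have hli : l ≠ i := by rintro rfl; omega
    simpa [hli] using h.pending l (by omega)

theorem EpochState.next_epoch (h : EpochState f xstar α e η k n z D) (hα : 0 ≤ α (k + 1)) :
    EpochState f xstar α e η (k + 1) 0 z ((1 + α (k + 1)) ^ 2 • D) :=
  ⟨fun _ hi => absurd hi (Nat.not_lt_zero _), fun i _ =>
    (h.updated i i.isLt).smul (by positivity)⟩

end Epoch

section Run

variable {n d : ℕ} [NeZero n] {f : Fin n → Vec d → ℝ} {α : ℕ → ℝ} {I₀ : Fin n → Mat d}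
  {x : ℕ → Vec d} {z : ℕ → Fin n → Vec d} {D : ℕ → Fin n → Mat d} {Q : ℕ → Mat d}
  {u : ℕ → Fin d → ℝ}

theorem idx_succ (n t : ℕ) [NeZero n] : (idx n (t + 1) : ℕ) = t % n := rfl

theorem ceil_succ_div (n t : ℕ) [NeZero n] : ⌈((t + 1 : ℕ) : ℝ) / n⌉₊ = t / n + 1 := by
  have hn : (0 : ℝ) < n := by exact_mod_cast NeZero.pos n
  rw [Nat.ceil_eq_iff (Nat.succ_ne_zero _), lt_div_iff₀ hn, div_le_iff₀ hn, Nat.succ_sub_one]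
  norm_cast
  exact ⟨Nat.lt_succ_of_le (Nat.div_mul_le_self t n),
    mul_comm n _ ▸ Nat.lt_mul_div_succ t (NeZero.pos n)⟩

theorem ceil_succ_div_sub_one (n t : ℕ) [NeZero n] :
    ⌈((t + 1 : ℕ) : ℝ) / n - 1⌉₊ = t / n := by
  rw [Nat.ceil_sub_one, ceil_succ_div, Nat.add_sub_cancel]

theorem IsRun.z_succ_eq_update (h : IsRun f α I₀ x z D Q u) (t : ℕ) :
    z (t + 1) = Function.update (z t) (idx n (t + 1)) (x (t + 1)) :=
  Function.eq_update_iff.2 ⟨h.z_succ t, h.z_succ_of_ne t⟩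

theorem IsRun.D_succ_eq_smul_update (h : IsRun f α I₀ x z D Q u) (t : ℕ) :
    D (t + 1) = omega n α (t + 1) • Function.update (D t) (idx n (t + 1))
      (bfgs (Q (t + 1)) (hess (f (idx n (t + 1))) (x (t + 1))) (u (t + 1))) := by
  ext1 i
  rcases eq_or_ne i (idx n (t + 1)) with rfl | hi
  · rw [Pi.smul_apply, Function.update_self, h.D_succ, h.z_succ]
  · rw [Pi.smul_apply, Function.update_of_ne hi, h.D_succ_of_ne t i hi]

variable {μ L Lt : ℝ} {xstar : Vec d} {e η : ℕ → ℝ}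

theorem IsRun.epochState_zero (h : IsRun f α I₀ x z D Q u) (hα : 0 ≤ α 0)
    (hI₀ : ∀ i, hess (f i) (x 0) ≤ I₀ i) (hx₀ : ‖x 0 - xstar‖ ≤ η 0)
    (hσ : ∀ i, sigma (I₀ i) (hess (f i) (x 0)) ≤ e 0) :
    EpochState f xstar α e η 0 0 (z 0) (D 0) := by
  refine ⟨fun i hi => absurd hi (Nat.not_lt_zero _), fun i _ => ?_⟩
  have hC : Controlled (f i) xstar 1 (e 0) (η 0) (x 0) (I₀ i) :=
    ⟨by rw [one_smul]; exact hI₀ i, by rw [one_smul]; exact hσ i, hx₀⟩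
  rw [h.z_zero, h.D_zero]
  exact hC.smul (by positivity)

theorem IsRun.controlled_succ [NeZero d] (h : IsRun f α I₀ x z D Q u)
    (hM : IsMajorant μ L Lt d α e η) (hμ : 0 < μ) (hR : ∀ i, IsRegular μ L Lt (f i)) {t : ℕ}
    (hS : EpochState f xstar α e η (t / n) (t % n) (z t) (D t))
    (hx : ‖x (t + 1) - xstar‖ ≤ η (t / n + 1)) :
    Controlled (f (idx n (t + 1))) xstar 1 (e (t / n + 1)) (η (t / n + 1)) (x (t + 1))
      (bfgs (Q (t + 1)) (hess (f (idx n (t + 1))) (x (t + 1))) (u (t + 1))) := by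
  have hQ := h.Q_succ t
  have hu := h.u_succ t
  rw [h.z_succ, ceil_succ_div_sub_one] at hQ
  rw [h.z_succ] at hu
  generalize hi : idx n (t + 1) = i at hQ hu ⊢
  have hLt := (hR i).lipschitzHessian.nonneg
  have hold := hS.pending i (by rw [← hi, idx_succ])
  have hstep : ‖x (t + 1) - z t i‖ ≤ 2 * η (t / n) := by
    have := norm_sub_le_norm_sub_add_norm_sub (x (t + 1)) xstar (z t i)
    rw [norm_sub_rev xstar] at this
    linarith [hold.norm_le, hM.antitone_radius (t / n).le_succ]
  have hfactor : 1 + Lt * ‖x (t + 1) - z t i‖ / 2 / μ ≤ 1 + α (t / n) := by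
    gcongr
    calc Lt * ‖x (t + 1) - z t i‖ / 2 / μ ≤ Lt * (2 * η (t / n)) / 2 / μ := by gcongr
      _ = Lt * η (t / n) / μ := by ring
      _ ≤ α (t / n) := hM.div_le_factor _
  rw [hQ] at hu ⊢
  exact (hold.bfgs_bfgs (hR i) hμ hx hfactor hu).mono (hM.error_succ _) le_rfl

theorem IsRun.epochState_succ (h : IsRun f α I₀ x z D Q u) {t : ℕ} (hα : 0 ≤ α (t / n + 1))
    (hS : EpochState f xstar α e η (t / n) (t % n) (z t) (D t))
    (hC : Controlled (f (idx n (t + 1))) xstar 1 (e (t / n + 1)) (η (t / n + 1)) (x (t + 1))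
      (bfgs (Q (t + 1)) (hess (f (idx n (t + 1))) (x (t + 1))) (u (t + 1)))) :
    EpochState f xstar α e η ((t + 1) / n) ((t + 1) % n) (z (t + 1)) (D (t + 1)) := by
  have hS' := EpochState.update (i := idx n (t + 1)) hS hC
  rw [idx_succ] at hS'
  rw [h.z_succ_eq_update, h.D_succ_eq_smul_update, omega, ceil_succ_div]
  rcases (Nat.add_one_le_iff.2 (Nat.mod_lt t (NeZero.pos n))).eq_or_lt with hlast | hlt
  · have hmod : (t + 1) % n = 0 := by rw [← Nat.mod_add_mod, hlast, Nat.mod_self]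
    rw [hlast] at hS'
    rw [if_pos hmod, hmod, Nat.succ_div_of_mod_eq_zero hmod]
    exact hS'.next_epoch hα
  · have hmod : (t + 1) % n = t % n + 1 := by rw [← Nat.mod_add_mod, Nat.mod_eq_of_lt hlt]
    have hne : (t + 1) % n ≠ 0 := by rw [hmod]; exact Nat.succ_ne_zero _
    rwa [if_neg hne, one_smul, hmod, Nat.succ_div_of_mod_ne_zero hne]

theorem IsRun.norm_sub_le [NeZero d] (h : IsRun f α I₀ x z D Q u)
    (hM : IsMajorant μ L Lt d α e η) (hμ : 0 < μ) (hR : ∀ i, IsRegular μ L Lt (f i))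
    (hgrad : ∑ i, gradient (f i) xstar = 0) (hI₀ : ∀ i, hess (f i) (x 0) ≤ I₀ i)
    (hx₀ : ‖x 0 - xstar‖ ≤ η 0) (hσ : ∀ i, sigma (I₀ i) (hess (f i) (x 0)) ≤ e 0) (t : ℕ) :
    ‖x (t + 1) - xstar‖ ≤ η (t / n + 1) := by
  have hα := hM.factor_nonneg hμ (hR 0).lipschitzHessian.nonneg
  have hx {t : ℕ} (hS : EpochState f xstar α e η (t / n) (t % n) (z t) (D t)) :
      ‖x (t + 1) - xstar‖ ≤ η (t / n + 1) := by
    rw [h.x_succ]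
    exact hS.norm_newton_sub_le hM hμ hR hgrad
  suffices hS : ∀ t, EpochState f xstar α e η (t / n) (t % n) (z t) (D t) from hx (hS t)
  intro t
  induction t with
  | zero => simpa using h.epochState_zero (hα 0) hI₀ hx₀ hσ
  | succ t hS => exact h.epochState_succ (hα _) hS (h.controlled_succ hM hμ hR hS (hx hS))

end Run

section Rates

variable {ε ρ q E : ℝ}

theorem one_add_pow_four_le {a : ℝ} (h0 : 0 ≤ a) (h1 : a ≤ 1) : (1 + a) ^ 4 ≤ 1 + 15 * a := by
  have hsq : a ^ 2 ≤ a := pow_le_of_le_one h0 h1 two_ne_zero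
  have hcube : a ^ 3 ≤ a := pow_le_of_le_one h0 h1 three_ne_zero
  have hfourth : a ^ 4 ≤ a := pow_le_of_le_one h0 h1 four_ne_zero
  linarith [show (1 + a) ^ 4 = 1 + 4 * a + 6 * a ^ 2 + 4 * a ^ 3 + a ^ 4 by ring]

theorem one_add_sq_le {a : ℝ} (h0 : 0 ≤ a) (h1 : a ≤ 1) : (1 + a) ^ 2 ≤ 1 + 3 * a := by
  have hsq : a ^ 2 ≤ a := pow_le_of_le_one h0 h1 two_ne_zero
  linarith [show (1 + a) ^ 2 = 1 + 2 * a + a ^ 2 by ring]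

/-- The superlinearly decreasing bound `ε ρ^k q^(k(k-1)/2)` on the distance of the iterates to the
minimizer at the start of epoch `k`. -/
noncomputable def radius (ε ρ q : ℝ) (k : ℕ) : ℝ :=
  ε * ρ ^ k * q ^ k.choose 2

/-- The bound on the errors of the Hessian approximations at the start of epoch `k`: the solution
of the recursion `e (k + 1) = q e k + E (1 - q) (q - ρ) ρ^k` with `e 0 = E (q - ρ)`. -/
noncomputable def hessError (E ρ q : ℝ) (k : ℕ) : ℝ :=
  E * ((1 - ρ) * q ^ k - (1 - q) * ρ ^ k)

theorem radius_zero (ε ρ q : ℝ) : radius ε ρ q 0 = ε := by simp [radius]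

theorem radius_succ (ε ρ q : ℝ) (k : ℕ) :
    radius ε ρ q (k + 1) = ρ * q ^ k * radius ε ρ q k := by
  rw [radius, radius, Nat.choose_succ_succ', Nat.choose_one_right]
  ring

theorem radius_nonneg (hε : 0 ≤ ε) (hρ : 0 ≤ ρ) (hq : 0 ≤ q) (k : ℕ) : 0 ≤ radius ε ρ q k := by
  unfold radius
  positivity

theorem radius_le (hε : 0 ≤ ε) (hρ : 0 ≤ ρ) (hq : 0 ≤ q) (hq1 : q ≤ 1) (k : ℕ) :
    radius ε ρ q k ≤ ε * ρ ^ k :=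
  mul_le_of_le_one_right (by positivity) (pow_le_one₀ hq hq1)

theorem antitone_radius (hε : 0 ≤ ε) (hρ : 0 ≤ ρ) (hρq : ρ ≤ q) (hq1 : q ≤ 1) :
    Antitone (radius ε ρ q) :=
  have hq := hρ.trans hρq
  antitone_nat_of_succ_le fun k => by
    rw [radius_succ]
    exact mul_le_of_le_one_left (radius_nonneg hε hρ hq k)
      (mul_le_one₀ (hρq.trans hq1) (by positivity) (pow_le_one₀ hq hq1))

theorem radius_succ_le (hε : 0 ≤ ε) (hρ : 0 ≤ ρ) (hρq : ρ ≤ q) (k : ℕ) :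
    radius ε ρ q (k + 1) ≤ ε * q ^ ((k + 2) * (k + 1) / 2) := by
  have hexp : (k + 2) * (k + 1) / 2 = (k + 1) + (k + 1).choose 2 := by
    have := Nat.choose_two_right (k + 2)
    rw [Nat.choose_succ_succ', Nat.choose_one_right] at this
    exact this.symm
  have hq := hρ.trans hρq
  rw [hexp, pow_add, ← mul_assoc, radius]
  gcongr

theorem hessError_zero (E ρ q : ℝ) : hessError E ρ q 0 = E * (q - ρ) := by
  rw [hessError]
  ring

theorem hessError_succ (E ρ q : ℝ) (k : ℕ) :
    hessError E ρ q (k + 1) = q * hessError E ρ q k + E * (1 - q) * (q - ρ) * ρ ^ k := by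
  rw [hessError, hessError]
  ring

theorem hessError_nonneg (hE : 0 ≤ E) (hρ : 0 ≤ ρ) (hρq : ρ ≤ q) (hq1 : q ≤ 1) (k : ℕ) :
    0 ≤ hessError E ρ q k := by
  refine mul_nonneg hE (sub_nonneg.2 ?_)
  gcongr
  linarith

theorem hessError_le (hE : 0 ≤ E) (hρ : 0 ≤ ρ) (hρq : ρ ≤ q) (hq1 : q ≤ 1) (k : ℕ) :
    hessError E ρ q k ≤ E * q ^ k := by
  refine mul_le_mul_of_nonneg_left ?_ hE
  have h₁ : 0 ≤ ρ * q ^ k := mul_nonneg hρ (pow_nonneg (hρ.trans hρq) k)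
  have h₂ : 0 ≤ (1 - q) * ρ ^ k := mul_nonneg (sub_nonneg.2 hq1) (pow_nonneg hρ k)
  linarith

theorem antitone_hessError (hE : 0 ≤ E) (hρ : 0 ≤ ρ) (hρq : ρ ≤ q) (hq1 : q ≤ 1) :
    Antitone (hessError E ρ q) := by
  refine antitone_nat_of_succ_le fun k => sub_nonneg.1 ?_
  have hpow : ρ ^ k ≤ q ^ k := by gcongr
  calc 0 ≤ E * (1 - ρ) * (1 - q) * (q ^ k - ρ ^ k) :=
        mul_nonneg (mul_nonneg (mul_nonneg hE (by linarith)) (by linarith)) (by linarith)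
    _ = hessError E ρ q k - hessError E ρ q (k + 1) := by
        rw [hessError, hessError]
        ring

theorem hessError_recursion_le {d : ℕ} {c : ℝ} (hE : 0 ≤ E) (hE1 : E ≤ 1) (hρ : 0 ≤ ρ)
    (hρq : ρ ≤ q) (hq1 : q ≤ 1) (hc : 0 ≤ c) (hc1 : c ≤ 1)
    (hcE : q * (15 * c * (d + 1)) ≤ E * (1 - q) * (q - ρ)) (k : ℕ) :
    q * ((1 + c * ρ ^ k) ^ 4 * (d + hessError E ρ q k) - d) ≤ hessError E ρ q (k + 1) := by
  have hq := hρ.trans hρq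
  have he := hessError_nonneg hE hρ hρq hq1 k
  have he1 : hessError E ρ q k ≤ 1 := (hessError_le hE hρ hρq hq1 k).trans
    (mul_le_one₀ hE1 (by positivity) (pow_le_one₀ hq hq1))
  have hcρ : c * ρ ^ k ≤ 1 :=
    mul_le_one₀ hc1 (by positivity) (pow_le_one₀ hρ (hρq.trans hq1))
  rw [hessError_succ]
  calc q * ((1 + c * ρ ^ k) ^ 4 * (d + hessError E ρ q k) - d)
      ≤ q * ((1 + 15 * (c * ρ ^ k)) * (d + hessError E ρ q k) - d) := by
        gcongr
        exact one_add_pow_four_le (by positivity) hcρ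
    _ = q * hessError E ρ q k + q * (15 * c * (d + hessError E ρ q k)) * ρ ^ k := by ring
    _ ≤ q * hessError E ρ q k + q * (15 * c * (d + 1)) * ρ ^ k := by gcongr
    _ ≤ q * hessError E ρ q k + E * (1 - q) * (q - ρ) * ρ ^ k := by gcongr

theorem radius_recursion_le {d : ℕ} {μ L Lt c : ℝ} (hL : 0 ≤ L) (hLt : 0 ≤ Lt) (hE : 0 ≤ E)
    (hE1 : E ≤ 1) (hε : 0 ≤ ε) (hρ : 0 ≤ ρ) (hρq : ρ ≤ q) (hq1 : q ≤ 1) (hc : 0 ≤ c)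
    (hc1 : c ≤ 1) (hcμ : L * (E + 3 * c * (d + 1)) + Lt * ε ≤ μ * ρ) (k : ℕ) :
    (L * ((1 + c * ρ ^ k) ^ 2 * (d + hessError E ρ q k) - d) + Lt * radius ε ρ q k) *
      radius ε ρ q k ≤ μ * radius ε ρ q (k + 1) := by
  have hq := hρ.trans hρq
  have hpow : ρ ^ k ≤ q ^ k := by gcongr
  have hEq : E * q ^ k ≤ 1 := mul_le_one₀ hE1 (by positivity) (pow_le_one₀ hq hq1)
  have hcρ : c * ρ ^ k ≤ 1 :=
    mul_le_one₀ hc1 (by positivity) (pow_le_one₀ hρ (hρq.trans hq1))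
  have he := hessError_nonneg hE hρ hρq hq1 k
  rw [radius_succ, ← mul_assoc]
  refine mul_le_mul_of_nonneg_right ?_ (radius_nonneg hε hρ hq k)
  calc _ ≤ L * ((1 + 3 * (c * ρ ^ k)) * (d + E * q ^ k) - d) + Lt * (ε * q ^ k) := by
        gcongr
        · exact one_add_sq_le (by positivity) hcρ
        · exact hessError_le hE hρ hρq hq1 k
        · exact (radius_le hε hρ hq hq1 k).trans (by gcongr)
    _ = L * (E * q ^ k + 3 * c * ρ ^ k * (d + E * q ^ k)) + Lt * (ε * q ^ k) := by ring
    _ ≤ L * (E * q ^ k + 3 * c * q ^ k * (d + 1)) + Lt * (ε * q ^ k) := by gcongr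
    _ = (L * (E + 3 * c * (d + 1)) + Lt * ε) * q ^ k := by ring
    _ ≤ μ * ρ * q ^ k := by gcongr
    _ = μ * (ρ * q ^ k) := by ring

theorem div_le_div_rpow_mul_sqrt {μ L Lt : ℝ} (hμ : 0 < μ) (hμL : μ ≤ L) (hLt : 0 ≤ Lt) :
    Lt / μ ≤ Lt / μ ^ (3 / 2 : ℝ) * √L := by
  have hrpow : μ ^ (3 / 2 : ℝ) = μ * √μ := by
    rw [Real.sqrt_eq_rpow, ← Real.rpow_one_add' hμ.le (by norm_num)]
    norm_num
  calc Lt / μ = Lt / (μ * √μ) * √μ := by field_simp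
    _ ≤ Lt / μ ^ (3 / 2 : ℝ) * √L := by rw [hrpow]; gcongr

theorem isMajorant_hessError_radius {d : ℕ} {μ L Lt c : ℝ} (hμ : 0 < μ) (hL : 0 ≤ L)
    (hLt : 0 ≤ Lt) (hq : 1 - μ / (d * L) = q) (hE : 0 ≤ E) (hE1 : E ≤ 1) (hε : 0 ≤ ε)
    (hρ : 0 ≤ ρ) (hρq : ρ ≤ q) (hεc : Lt / μ * ε ≤ c) (hc1 : c ≤ 1)
    (hcE : q * (15 * c * (d + 1)) ≤ E * (1 - q) * (q - ρ))
    (hcμ : L * (E + 3 * c * (d + 1)) + Lt * ε ≤ μ * ρ) :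
    IsMajorant μ L Lt d (fun k => c * ρ ^ k) (hessError E ρ q) (radius ε ρ q) := by
  have hq1 : q ≤ 1 := hq ▸ sub_le_self _ (by positivity)
  have hc : 0 ≤ c := le_trans (by positivity) hεc
  refine ⟨antitone_hessError hE hρ hρq hq1, antitone_radius hε hρ hρq hq1,
    radius_nonneg hε hρ (hρ.trans hρq), fun k => ?_, fun k => ?_,
    radius_recursion_le hL hLt hE hE1 hε hρ hρq hq1 hc hc1 hcμ⟩
  · calc Lt * radius ε ρ q k / μ ≤ Lt * (ε * ρ ^ k) / μ := by
          gcongr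
          exact radius_le hε hρ (hρ.trans hρq) hq1 k
      _ = Lt / μ * ε * ρ ^ k := by ring
      _ ≤ c * ρ ^ k := by gcongr
  · rw [hq]
    exact hessError_recursion_le hE hE1 hρ hρq hq1 hc hc1 hcE k

theorem eventually_mul_le (a : ℝ) {b : ℝ} (hb : 0 < b) :
    ∀ᶠ x in nhdsWithin (0 : ℝ) (Set.Ioi 0), a * x ≤ b := by
  have : Filter.Tendsto (a * ·) (nhdsWithin (0 : ℝ) (Set.Ioi 0)) (nhds (a * 0)) :=
    (Continuous.tendsto (by fun_prop) 0).mono_left nhdsWithin_le_nhds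
  rw [mul_zero] at this
  exact this.eventually_le_const hb

theorem exists_isMajorant_alpha {d : ℕ} [NeZero d] {μ L Lt : ℝ} (hμ : 0 < μ) (hμL : μ ≤ L)
    (hLt : 0 ≤ Lt) (hρ : 0 < ρ) (hρq : ρ < 1 - μ / (d * L)) :
    ∃ ε, 0 < ε ∧ ∃ e η, 0 < e 0 ∧ η 0 = ε ∧ IsMajorant μ L Lt d (alpha μ L Lt ε ρ) e η ∧
      ∀ k, η (k + 1) ≤ ε * (1 - μ / (d * L)) ^ ((k + 2) * (k + 1) / 2) := by
  have hL : 0 < L := hμ.trans_le hμL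
  have hd : (0 : ℝ) < d := by exact_mod_cast NeZero.pos d
  have hq1 : 1 - μ / (d * L) < 1 := sub_lt_self _ (by positivity)
  have hγ := div_le_div_rpow_mul_sqrt hμ hμL hLt
  generalize hq : 1 - μ / (d * L) = q at *
  let γ := Lt / μ ^ (3 / 2 : ℝ) * √L
  obtain ⟨E, hE1, hEμ, hE⟩ := ((eventually_mul_le 1 one_pos).and
    ((eventually_mul_le L (mul_pos hμ hρ |> half_pos)).and self_mem_nhdsWithin)).exists
  have hgap : 0 < E * (1 - q) * (q - ρ) :=
    mul_pos (mul_pos hE (sub_pos.2 hq1)) (sub_pos.2 hρq)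
  obtain ⟨ε, hε1, hεE, hεμ, hε⟩ := ((eventually_mul_le γ one_pos).and
    ((eventually_mul_le (q * (15 * γ * (d + 1))) hgap).and
    ((eventually_mul_le (L * (3 * γ * (d + 1)) + Lt) (mul_pos hμ hρ |> half_pos)).and
    self_mem_nhdsWithin))).exists
  rw [one_mul] at hE1
  refine ⟨ε, hε, hessError E ρ q, radius ε ρ q, ?_, radius_zero ε ρ q, ?_,
    radius_succ_le hε.le hρ.le hρq.le⟩
  · rw [hessError_zero]
    exact mul_pos hE (sub_pos.2 hρq)
  · exact isMajorant_hessError_radius hμ hL.le hLt hq hE.le hE1 hε.le hρ.le hρq.le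
      (by gcongr) hε1 (by linarith) (by linarith)

end Rates

end SLIQN

theorem theorem1 {n d : ℕ} [NeZero n] [NeZero d] (μ L Lt : ℝ) (hμ : 0 < μ)
    (f : Fin n → SLIQN.Vec d → ℝ)
    (hf : ∀ i, ContDiff ℝ 2 (f i))
    (hconv : ∀ i, SLIQN.StronglyConvex μ (f i))
    (hsmooth : ∀ i, SLIQN.Smooth L (f i))
    (hLip : ∀ i, SLIQN.LipschitzHessian Lt (f i))
    (xstar : SLIQN.Vec d)
    (hmin : ∀ y, (1 / (n : ℝ)) * ∑ i, f i xstar ≤ (1 / (n : ℝ)) * ∑ i, f i y)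
    (ρ : ℝ) (hρ0 : 0 < ρ) (hρ1 : ρ < 1 - μ / (d * L)) :
    ∃ ε : ℝ, 0 < ε ∧ ∃ σ₀ : ℝ, 0 < σ₀ ∧
      ∀ (I₀ : Fin n → SLIQN.Mat d) (x : ℕ → SLIQN.Vec d) (z : ℕ → Fin n → SLIQN.Vec d)
        (D : ℕ → Fin n → SLIQN.Mat d) (Q : ℕ → SLIQN.Mat d) (u : ℕ → Fin d → ℝ),
        SLIQN.IsRun f (SLIQN.alpha μ L Lt ε ρ) I₀ x z D Q u →
        (∀ i, (I₀ i - SLIQN.hess (f i) (x 0)).PosSemidef) →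
        ‖x 0 - xstar‖ ≤ ε →
        (∀ i, SLIQN.sigma (I₀ i) (SLIQN.hess (f i) (x 0)) ≤ σ₀) →
        ∃ ζ : ℕ → ℝ,
          (∀ t : ℕ, 1 ≤ t → ‖x t - xstar‖ ≤ ζ ((t - 1) / n)) ∧
          ∀ k : ℕ, ζ k ≤ ε * (1 - μ / (d * L)) ^ ((k + 2) * (k + 1) / 2) := by
  have hR (i : Fin n) : SLIQN.IsRegular μ L Lt (f i) := ⟨hf i, hconv i, hsmooth i, hLip i⟩
  have hn : (0 : ℝ) < 1 / n := one_div_pos.2 (by exact_mod_cast NeZero.pos n)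
  have hgrad : ∑ i, gradient (f i) xstar = 0 :=
    SLIQN.sum_gradient_eq_zero_of_isLocalMin
      (fun i _ => (hf i).contDiffAt.differentiableAt two_ne_zero)
      (.of_forall fun y => le_of_mul_le_mul_left (hmin y) hn)
  obtain ⟨ε, hε, e, η, he, hη, hM, hrate⟩ := SLIQN.exists_isMajorant_alpha hμ
    ((hconv 0).le_of_smooth (hsmooth 0)) (hLip 0).nonneg hρ0 hρ1
  refine ⟨ε, hε, e 0, he, fun I₀ x z D Q u hrun hI₀ hx₀ hσ => ⟨fun k => η (k + 1), ?_, hrate⟩⟩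
  intro t ht
  obtain ⟨t, rfl⟩ := Nat.exists_eq_add_of_le' ht
  exact hrun.norm_sub_le hM hμ hR hgrad (fun i => Matrix.le_iff.2 (hI₀ i)) (hη.symm ▸ hx₀) hσ t
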